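/- Let $0\le a,b\le 1$ and let $$T=\begin{pmatrix} a & 1-b\\ 1-a & b\end{pmatrix}.$$ A qubit channel is a completely positive trace-preserving linear map $\Phi$ on the complex $2\times2$ matrices. It has classical action $T$ if $\langle k|\Phi(|l\rangle\langle l|)|k\rangle=T_{kl}$ for all $k,l$, where $\{|k\rangle\}$ is the fixed standard basis. Channels $\Phi^{(1)},\dots,\Phi^{(M)}$ are perfectly distinguishable if there are a finite-dimensional ancilla, a (possibly entangled) state $\rho$ of the qubit and the ancilla, and a measurement (POVM) $\{E_1,\dots,E_M\}$ such that $$\frac1M\sum_{n=1}^{M}\operatorname{tr}\bigl[E_n\,(\Phi^{(n)}\otimes\mathcal I)(\rho)\bigr]=1,$$ i.e. a channel drawn uniformly at random from the list is identified with probability one by a single use. The distinguishability number $\mathcal M(T)$ is the largest number $M$ for which there exist $M$ perfectly distinguishable qubit channels that all have classical action $T$. Then $$\mathcal M(T)=\begin{cases}2 & \text{if } 0<|a-b|\le \tfrac12,\\[2pt] 3 & \text{if } a=b \text{ and } a\in[\tfrac13,\tfrac23]\setminus\{\tfrac12\},\\[2pt] 4 & \text{if } a=b=\tfrac12.\end{cases}$$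 -/

import Mathlib

namespace QubitDist

open Matrix
open scoped ComplexOrder

/-- Linear maps (superoperators) on the `d × d` complex matrices. -/
abbrev Superop (d : ℕ) : Type :=
  Matrix (Fin d) (Fin d) ℂ →ₗ[ℂ] Matrix (Fin d) (Fin d) ℂ

/-- The extended map `Φ ⊗ I` on operators on `ℂ^d ⊗ ℂ^r`, where `I` is the identity map on
the `r × r` matrices: for each pair `k, l` of basis indices of the ancilla, `Φ` acts on the
block `(i, j) ↦ X (i, k) (j, l)`. -/
def ampliate {d : ℕ} (Φ : Superop d) (r : ℕ)
    (X : Matrix (Fin d × Fin r) (Fin d × Fin r) ℂ) :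
    Matrix (Fin d × Fin r) (Fin d × Fin r) ℂ :=
  Matrix.of fun p q => Φ (Matrix.of fun i j => X (i, p.2) (j, q.2)) p.1 q.1

/-- A quantum channel: a completely positive trace preserving map. -/
structure IsChannel {d : ℕ} (Φ : Superop d) : Prop where
  completelyPositive : ∀ (r : ℕ) (X : Matrix (Fin d × Fin r) (Fin d × Fin r) ℂ),
    X.PosSemidef → (ampliate Φ r X).PosSemidef
  tracePreserving : ∀ X : Matrix (Fin d) (Fin d) ℂ, (Φ X).trace = X.trace

/-- `Φ` has classical action `T`, i.e. `⟨k| Φ(|l⟩⟨l|) |k⟩ = T k l` for all `k, l`. -/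
def HasClassicalAction {d : ℕ} (Φ : Superop d) (T : Matrix (Fin d) (Fin d) ℝ) : Prop :=
  ∀ k l : Fin d, Φ (Matrix.single l l 1) k k = (T k l : ℂ)

/-- A density matrix (quantum state). -/
structure IsState {n : Type*} [Fintype n] (ρ : Matrix n n ℂ) : Prop where
  posSemidef : ρ.PosSemidef
  trace_eq_one : ρ.trace = 1

/-- A general quantum measurement (POVM) with outcomes in `Fin M`. -/
structure IsPOVM {n : Type*} [Fintype n] [DecidableEq n] {M : ℕ}
    (E : Fin M → Matrix n n ℂ) : Prop where
  posSemidef : ∀ m, (E m).PosSemidef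
  sum_eq_one : ∑ m, E m = 1

/-- The probability of identifying correctly a channel drawn uniformly from `Φ 0, …, Φ (M-1)`,
when it acts once on the first part of the bipartite input `ρ`, the output is measured with
the POVM `E`, and the outcome is the guess. -/
noncomputable def successProb {d r M : ℕ} (Φ : Fin M → Superop d)
    (ρ : Matrix (Fin d × Fin r) (Fin d × Fin r) ℂ)
    (E : Fin M → Matrix (Fin d × Fin r) (Fin d × Fin r) ℂ) : ℝ :=
  (1 / (M : ℝ)) * ∑ m, ((E m * ampliate (Φ m) r ρ).trace).re

/-- The channels `Φ 0, …, Φ (M-1)` are perfectly distinguishable: some single-use protocol, with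
a (possibly entangled) input state on the system and a finite-dimensional ancilla, and a
general measurement of the output, succeeds with probability one. -/
def PerfectlyDistinguishable {d M : ℕ} (Φ : Fin M → Superop d) : Prop :=
  ∃ (r : ℕ) (ρ : Matrix (Fin d × Fin r) (Fin d × Fin r) ℂ)
    (E : Fin M → Matrix (Fin d × Fin r) (Fin d × Fin r) ℂ),
    IsState ρ ∧ IsPOVM E ∧ successProb Φ ρ E = 1

/-- The numbers `M` for which there are `M` perfectly distinguishable quantum channels, all with
classical action `T`. -/
def distinguishableCounts {d : ℕ} (T : Matrix (Fin d) (Fin d) ℝ) : Set ℕ :=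
  {M | ∃ Φ : Fin M → Superop d,
    (∀ m, IsChannel (Φ m)) ∧ (∀ m, HasClassicalAction (Φ m) T) ∧ PerfectlyDistinguishable Φ}

/-- `N` is the distinguishability number of `T`: the maximal number of quantum channels with
classical action `T` that can be perfectly distinguished. -/
def IsDistinguishabilityNumber {d : ℕ} (T : Matrix (Fin d) (Fin d) ℝ) (N : ℕ) : Prop :=
  IsGreatest (distinguishableCounts T) N

/-- The qubit classical action with parameters `a, b`. -/
def qubitAction (a b : ℝ) : Matrix (Fin 2) (Fin 2) ℝ :=
  !![a, 1 - b; 1 - a, b]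

end QubitDist

/-!
Perfect distinguishability forces the output states of different channels to be orthogonal. In
terms of Kraus operators `A`, `B` of two different channels this says `tr (Aᴴ B S) = 0`, where `S`
is the reduced state of the input on the system, and any density matrix `S` can be prescribed.

For the upper bounds, let `V m` be the span of the Kraus operators of the `m`-th channel. The
nonzero spaces `V m * S` are independent inside a space of dimension `d * rank S`, so at most
`d ^ 2` channels can be distinguished. More than `d * (d - 1)` of them force `S` to be invertible,
and then some `V m` is a line: that channel is unitary, so the rows of `T` sum to `1`. If there are
`d ^ 2` of them, all are unitary, and they form a basis of the matrix space; completeness of this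
basis makes every entry of `T` equal to `1 / d`.

For the lower bounds, two unitaries in `SU(2)` are orthogonal for the trace form exactly when the
corresponding unit quaternions are orthogonal, which gives three or four channels. Two channels
are obtained by flipping the phase of one output row of a channel that sends some pure state to the
superposition `(1, 1) / √2`.
-/

namespace QubitDist

open Matrix
open scoped ComplexOrder Kronecker MatrixOrder

section StateDiscrimination

variable {n : Type*} [Fintype n]

theorem exists_eq_mul_conjTranspose {A : Matrix n n ℂ} (hA : A.PosSemidef) :
    ∃ B : Matrix n n ℂ, A = B * Bᴴ := by
  classical
  exact CStarAlgebra.nonneg_iff_eq_mul_star_self.1 hA.nonneg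

theorem trace_mul_nonneg {A B : Matrix n n ℂ} (hA : A.PosSemidef) (hB : B.PosSemidef) :
    0 ≤ (A * B).trace := by
  obtain ⟨R, rfl⟩ := exists_eq_mul_conjTranspose hB
  rw [← Matrix.mul_assoc, trace_mul_comm, ← Matrix.mul_assoc]
  exact (hA.conjTranspose_mul_mul_same R).trace_nonneg

theorem trace_mul_eq_zero_iff {A B : Matrix n n ℂ} (hA : A.PosSemidef) (hB : B.PosSemidef) :
    (A * B).trace = 0 ↔ A * B = 0 := by
  refine ⟨fun h => ?_, fun h => by rw [h, trace_zero]⟩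
  obtain ⟨Q, rfl⟩ := exists_eq_mul_conjTranspose hA
  obtain ⟨R, rfl⟩ := exists_eq_mul_conjTranspose hB
  have hQR : ((Qᴴ * R)ᴴ * (Qᴴ * R)).trace = 0 := by
    rw [conjTranspose_mul, conjTranspose_conjTranspose, Matrix.mul_assoc, trace_mul_comm,
      ← Matrix.mul_assoc, Matrix.mul_assoc]
    exact h
  rw [mul_self_mul_conjTranspose_eq_zero, self_mul_conjTranspose_mul_eq_zero,
    ← trace_conjTranspose_mul_self_eq_zero_iff, hQR]

theorem exists_isStarProjection_supports {M : ℕ} {σ : Fin M → Matrix n n ℂ}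
    (hσ : ∀ m, (σ m).IsHermitian) (hσσ : Pairwise fun i j => σ i * σ j = 0) :
    ∃ P : Fin M → Matrix n n ℂ, (∀ m, IsStarProjection (P m)) ∧
      (Pairwise fun i j => P i * P j = 0) ∧ ∀ m, P m * σ m = σ m := by
  classical
  let e := toEuclideanCLM (n := n) (𝕜 := ℂ)
  let V m := LinearMap.range (e (σ m)).toLinearMap
  have hV : Pairwise fun i j => V i ⟂ V j := by
    intro i j hij
    rw [Submodule.isOrtho_iff_inner_eq]
    rintro _ ⟨x, rfl⟩ _ ⟨y, rfl⟩
    have hadj : (e (σ i)).adjoint = e (σ i) := by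
      rw [← ContinuousLinearMap.star_eq_adjoint, ← map_star, star_eq_conjTranspose, hσ i]
    have hmul : e (σ i) (e (σ j) y) = 0 := by
      rw [← mul_apply_eq_comp, ← map_mul, hσσ hij, map_zero,
        _root_.zero_apply]
    calc inner ℂ (e (σ i) x) (e (σ j) y) = inner ℂ x ((e (σ i)).adjoint (e (σ j) y)) :=
          (ContinuousLinearMap.adjoint_inner_right _ _ _).symm
      _ = 0 := by rw [hadj, hmul, inner_zero_right]
  refine ⟨fun m => e.symm (V m).starProjection, fun m => ?_, fun i j hij => ?_, fun m => ?_⟩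
  · exact isStarProjection_starProjection.map e.symm
  · change e.symm _ * e.symm _ = 0
    rw [← map_mul]
    exact (congrArg e.symm (hV hij).starProjection_comp_starProjection).trans (map_zero _)
  · refine EquivLike.injective e ?_
    rw [map_mul, e.apply_symm_apply]
    ext1 x
    exact Submodule.starProjection_eq_self_iff.2 ⟨x, rfl⟩

variable [DecidableEq n]

theorem IsPOVM.posSemidef_one_sub_sum {M : ℕ} {E : Fin M → Matrix n n ℂ} (hE : IsPOVM E)
    (s : Finset (Fin M)) : (1 - ∑ m ∈ s, E m).PosSemidef := by
  rw [← hE.sum_eq_one, ← Finset.sum_compl_add_sum s, add_sub_cancel_right]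
  exact posSemidef_sum _ fun m _ => hE.posSemidef m

theorem IsPOVM.re_trace_mul_le_one {M : ℕ} {E : Fin M → Matrix n n ℂ} (hE : IsPOVM E)
    {σ : Matrix n n ℂ} (hσ : IsState σ) (m : Fin M) : (E m * σ).trace.re ≤ 1 := by
  have h := trace_mul_nonneg (hE.posSemidef_one_sub_sum {m}) hσ.posSemidef
  rw [Finset.sum_singleton, Matrix.sub_mul, Matrix.one_mul, trace_sub, hσ.trace_eq_one,
    sub_nonneg] at h
  simpa using (Complex.le_def.1 h).1

theorem IsPOVM.mul_eq_self {M : ℕ} {E : Fin M → Matrix n n ℂ} (hE : IsPOVM E)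
    {σ : Matrix n n ℂ} (hσ : IsState σ) {m : Fin M} (h : (E m * σ).trace.re = 1) :
    E m * σ = σ := by
  have htr : (E m * σ).trace = 1 := by
    refine Complex.ext h ?_
    simpa using (Complex.le_def.1 (trace_mul_nonneg (hE.posSemidef m) hσ.posSemidef)).2.symm
  have h0 : (1 - E m) * σ = 0 := by
    refine (trace_mul_eq_zero_iff ?_ hσ.posSemidef).1 ?_
    · simpa using hE.posSemidef_one_sub_sum {m}
    · rw [Matrix.sub_mul, Matrix.one_mul, trace_sub, hσ.trace_eq_one, htr, sub_self]
  rw [Matrix.sub_mul, Matrix.one_mul, sub_eq_zero] at h0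
  exact h0.symm

theorem IsPOVM.mul_eq_zero {M : ℕ} {E : Fin M → Matrix n n ℂ} (hE : IsPOVM E)
    {σ : Matrix n n ℂ} (hσ : σ.PosSemidef) {i j : Fin M} (hij : i ≠ j) (h : E j * σ = σ) :
    E i * σ = 0 := by
  refine (trace_mul_eq_zero_iff (hE.posSemidef i) hσ).1 (le_antisymm ?_
    (trace_mul_nonneg (hE.posSemidef i) hσ))
  have hpair := trace_mul_nonneg (hE.posSemidef_one_sub_sum {i, j}) hσ
  rw [Finset.sum_pair hij, Matrix.sub_mul, Matrix.add_mul, h, Matrix.one_mul,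
    sub_add_cancel_right, trace_neg] at hpair
  exact neg_nonneg.1 hpair

theorem IsPOVM.mul_states_eq_zero {M : ℕ} {E : Fin M → Matrix n n ℂ} (hE : IsPOVM E)
    {σ : Fin M → Matrix n n ℂ} (hσ : ∀ m, (σ m).PosSemidef) (h : ∀ m, E m * σ m = σ m) :
    Pairwise fun i j => σ i * σ j = 0 := by
  intro i j hij
  calc σ i * σ j = (E j * σ i)ᴴ * σ j := by
        rw [conjTranspose_mul, (hE.posSemidef j).isHermitian, (hσ i).isHermitian,
          Matrix.mul_assoc, h]
    _ = 0 := by rw [hE.mul_eq_zero (hσ i) hij.symm (h i), conjTranspose_zero, Matrix.zero_mul]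

theorem exists_isPOVM_of_pairwise_mul_eq_zero {M : ℕ} (hM : M ≠ 0) {σ : Fin M → Matrix n n ℂ}
    (hσ : ∀ m, (σ m).IsHermitian) (hσσ : Pairwise fun i j => σ i * σ j = 0) :
    ∃ E : Fin M → Matrix n n ℂ, IsPOVM E ∧ ∀ m, E m * σ m = σ m := by
  obtain ⟨P, hP, hPP, hPσ⟩ := exists_isStarProjection_supports hσ hσσ
  have hQ : IsStarProjection (1 - ∑ m, P m) := by
    refine IsStarProjection.one_sub ⟨?_, ?_⟩
    · exact (OrthogonalIdempotents.mk (fun m => (hP m).isIdempotentElem) hPP).isIdempotentElem_sum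
    · exact isSelfAdjoint_sum _ fun m _ => (hP m).isSelfAdjoint
  refine ⟨fun m => P m + (M : ℂ)⁻¹ • (1 - ∑ i, P i), ⟨fun m => ?_, ?_⟩, fun m => ?_⟩
  · exact (nonneg_iff_posSemidef.1 (hP m).nonneg).add
      ((nonneg_iff_posSemidef.1 hQ.nonneg).smul (by positivity))
  · rw [Finset.sum_add_distrib, Finset.sum_const, Finset.card_univ, Fintype.card_fin,
      ← Nat.cast_smul_eq_nsmul ℂ, smul_smul, mul_inv_cancel₀ (Nat.cast_ne_zero.2 hM), one_smul,
      add_sub_cancel]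
  · have hsum : (∑ i, P i) * σ m = σ m := by
      rw [Finset.sum_mul, Finset.sum_eq_single m, hPσ]
      · intro i _ him
        rw [← hPσ m, ← Matrix.mul_assoc, hPP him, Matrix.zero_mul]
      · simp
    rw [Matrix.add_mul, hPσ, smul_mul, Matrix.sub_mul, hsum, Matrix.one_mul, sub_self, smul_zero,
      add_zero]

theorem exists_isPOVM_iff_pairwise_mul_eq_zero {M : ℕ} (hM : M ≠ 0) {σ : Fin M → Matrix n n ℂ}
    (hσ : ∀ m, IsState (σ m)) :
    (∃ E : Fin M → Matrix n n ℂ, IsPOVM E ∧ (1 / (M : ℝ)) * ∑ m, (E m * σ m).trace.re = 1) ↔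
      Pairwise fun i j => σ i * σ j = 0 := by
  constructor
  · rintro ⟨E, hE, hsucc⟩
    have hsum : ∑ m, (E m * σ m).trace.re = ∑ _m : Fin M, (1 : ℝ) := by
      field_simp at hsucc
      simpa using hsucc
    have hone := (Finset.sum_eq_sum_iff_of_le fun m _ => hE.re_trace_mul_le_one (hσ m) m).1 hsum
    exact hE.mul_states_eq_zero (fun m => (hσ m).posSemidef)
      fun m => hE.mul_eq_self (hσ m) (hone m (Finset.mem_univ m))
  · intro hσσ
    obtain ⟨E, hE, hEσ⟩ :=
      exists_isPOVM_of_pairwise_mul_eq_zero hM (fun m => (hσ m).posSemidef.isHermitian) hσσ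
    refine ⟨E, hE, ?_⟩
    simp [hEσ, (hσ _).trace_eq_one, hM]

end StateDiscrimination

section KrausMap

variable {d : ℕ} {ι : Type*} [Fintype ι]

/-- The completely positive map with Kraus operators `K j`. -/
def krausMap (K : ι → Matrix (Fin d) (Fin d) ℂ) : Superop d where
  toFun X := ∑ j, K j * X * (K j)ᴴ
  map_add' X Y := by simp only [mul_add, add_mul, Finset.sum_add_distrib]
  map_smul' c X := by simp [Finset.smul_sum]

theorem krausMap_apply (K : ι → Matrix (Fin d) (Fin d) ℂ) (X : Matrix (Fin d) (Fin d) ℂ) :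
    krausMap K X = ∑ j, K j * X * (K j)ᴴ := rfl

theorem ampliate_krausMap (K : ι → Matrix (Fin d) (Fin d) ℂ) (r : ℕ)
    (X : Matrix (Fin d × Fin r) (Fin d × Fin r) ℂ) :
    ampliate (krausMap K) r X =
      ∑ j, (K j ⊗ₖ (1 : Matrix (Fin r) (Fin r) ℂ)) * X *
        (K j ⊗ₖ (1 : Matrix (Fin r) (Fin r) ℂ))ᴴ := by
  ext ⟨k, q⟩ ⟨k', q'⟩
  simp [ampliate, krausMap_apply, Matrix.sum_apply, mul_apply, Fintype.sum_prod_type, one_apply,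
    Finset.sum_mul, apply_ite (starRingEnd ℂ)]

theorem krausMap_single_apply (K : ι → Matrix (Fin d) (Fin d) ℂ) (l l' k k' : Fin d) :
    krausMap K (single l l' 1) k k' = ∑ j, K j k l * star (K j k' l') := by
  simp [krausMap_apply, Matrix.sum_apply, mul_apply, single_apply, ite_and]

theorem trace_krausMap (K : ι → Matrix (Fin d) (Fin d) ℂ) (X : Matrix (Fin d) (Fin d) ℂ) :
    (krausMap K X).trace = ((∑ j, (K j)ᴴ * K j) * X).trace := by
  rw [krausMap_apply, trace_sum, Finset.sum_mul, trace_sum]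
  exact Finset.sum_congr rfl fun j _ => by rw [trace_mul_comm, ← Matrix.mul_assoc]

theorem isChannel_krausMap_iff {K : ι → Matrix (Fin d) (Fin d) ℂ} :
    IsChannel (krausMap K) ↔ ∑ j, (K j)ᴴ * K j = 1 := by
  refine ⟨fun h => ext_iff_trace_mul_right.2 fun X => ?_, fun h => ⟨fun r X hX => ?_, fun X => ?_⟩⟩
  · rw [← trace_krausMap, h.tracePreserving, Matrix.one_mul]
  · rw [ampliate_krausMap]
    exact posSemidef_sum _ fun j _ => hX.mul_mul_conjTranspose_same _
  · rw [trace_krausMap, h, Matrix.one_mul]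

theorem hasClassicalAction_krausMap_iff {K : ι → Matrix (Fin d) (Fin d) ℂ}
    {T : Matrix (Fin d) (Fin d) ℝ} :
    HasClassicalAction (krausMap K) T ↔ ∀ k l, ∑ j, ‖K j k l‖ ^ 2 = T k l := by
  refine forall₂_congr fun k l => ?_
  rw [krausMap_single_apply, ← Complex.ofReal_inj]
  simp [Complex.mul_conj']

theorem exists_eq_krausMap {Φ : Superop d}
    (hΦ : ∀ (r : ℕ) (X : Matrix (Fin d × Fin r) (Fin d × Fin r) ℂ),
      X.PosSemidef → (ampliate Φ r X).PosSemidef) :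
    ∃ (s : ℕ) (K : Fin s → Matrix (Fin d) (Fin d) ℂ), Φ = krausMap K := by
  -- `ω` is the unnormalised maximally entangled vector, so `ampliate Φ d` of its projection is the
  -- Choi matrix of `Φ`, and a rank-one decomposition of that matrix lists the Kraus operators.
  let ω : Fin d × Fin d → ℂ := fun p => if p.1 = p.2 then 1 else 0
  obtain ⟨s, v, hv⟩ := posSemidef_iff_eq_sum_vecMulVec.1
    (hΦ d _ (posSemidef_vecMulVec_self_star ω))
  refine ⟨s, fun j => Matrix.of fun k l => v j (k, l), ?_⟩
  refine Matrix.ext_linearMap ℂ fun l l' => LinearMap.ext_ring ?_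
  ext k k'
  have hω : (Matrix.of fun i j => vecMulVec ω (star ω) (i, l) (j, l') :
      Matrix (Fin d) (Fin d) ℂ) = single l l' 1 := by
    ext i j
    simp [ω, vecMulVec_apply, single_apply, ← ite_and, eq_comm, and_comm]
  have hChoi := congrFun₂ hv (k, l) (k', l')
  simp only [ampliate, of_apply, hω] at hChoi
  simp [hChoi, krausMap_single_apply, Matrix.sum_apply, vecMulVec_apply]

theorem trace_ampliate {Φ : Superop d} (hΦ : ∀ X, (Φ X).trace = X.trace) (r : ℕ)
    (X : Matrix (Fin d × Fin r) (Fin d × Fin r) ℂ) : (ampliate Φ r X).trace = X.trace := by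
  have h (q : Fin r) := hΦ (Matrix.of fun i j => X (i, q) (j, q))
  simp only [trace, diag_apply, of_apply] at h
  simp only [trace, diag_apply, Fintype.sum_prod_type_right, ampliate, of_apply, h]

theorem IsState.ampliate {Φ : Superop d} (hΦ : IsChannel Φ) {r : ℕ}
    {ρ : Matrix (Fin d × Fin r) (Fin d × Fin r) ℂ} (hρ : IsState ρ) :
    IsState (ampliate Φ r ρ) :=
  ⟨hΦ.completelyPositive r ρ hρ.posSemidef,
    (trace_ampliate hΦ.tracePreserving r ρ).trans hρ.trace_eq_one⟩

end KrausMap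

section PartialTrace

variable {m n : Type*} [Fintype n]

/-- The partial trace over the second tensor factor. -/
def partialTrace (ρ : Matrix (m × n) (m × n) ℂ) : Matrix m m ℂ :=
  Matrix.of fun i j => ∑ k, ρ (i, k) (j, k)

theorem partialTrace_vecMulVec_uncurry (R : Matrix m n ℂ) :
    partialTrace (vecMulVec (Function.uncurry R) (star (Function.uncurry R))) = R * Rᴴ := by
  ext i j
  simp [partialTrace, vecMulVec_apply, mul_apply, Function.uncurry]

variable [Fintype m]

theorem trace_partialTrace (ρ : Matrix (m × n) (m × n) ℂ) :
    (partialTrace ρ).trace = ρ.trace := by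
  simp [partialTrace, trace, Fintype.sum_prod_type]

theorem trace_kronecker_one_mul [DecidableEq n] (A : Matrix m m ℂ) (ρ : Matrix (m × n) (m × n) ℂ) :
    ((A ⊗ₖ (1 : Matrix n n ℂ)) * ρ).trace = (A * partialTrace ρ).trace := by
  simp only [trace, diag_apply, mul_apply, Fintype.sum_prod_type, kroneckerMap_apply, one_apply,
    mul_ite, mul_one, mul_zero, ite_mul, zero_mul, Finset.sum_ite_eq, Finset.mem_univ, if_true,
    partialTrace, of_apply, Finset.mul_sum]
  exact Finset.sum_congr rfl fun i _ => Finset.sum_comm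

theorem IsState.partialTrace {ρ : Matrix (m × n) (m × n) ℂ} (hρ : IsState ρ) :
    IsState (partialTrace ρ) := by
  refine ⟨?_, (trace_partialTrace ρ).trans hρ.trace_eq_one⟩
  have hsum : QubitDist.partialTrace ρ = ∑ k, ρ.submatrix (·, k) (·, k) := by
    ext i j
    simp [QubitDist.partialTrace, Matrix.sum_apply]
  rw [hsum]
  exact posSemidef_sum _ fun k _ => hρ.posSemidef.submatrix _

theorem exists_pure_partialTrace_eq {S : Matrix m m ℂ} (hS : IsState S) :
    ∃ ψ : m × m → ℂ, IsState (vecMulVec ψ (star ψ)) ∧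
      QubitDist.partialTrace (vecMulVec ψ (star ψ)) = S := by
  obtain ⟨R, rfl⟩ := exists_eq_mul_conjTranspose hS.posSemidef
  refine ⟨Function.uncurry R, ⟨posSemidef_vecMulVec_self_star _, ?_⟩,
    partialTrace_vecMulVec_uncurry R⟩
  rw [← trace_partialTrace, partialTrace_vecMulVec_uncurry, hS.trace_eq_one]

end PartialTrace

section Distinguishability

theorem mul_eq_zero_of_sum_mul_sum_eq_zero {n ι κ : Type*} [Fintype n] [Fintype ι] [Fintype κ]
    {A : ι → Matrix n n ℂ} {B : κ → Matrix n n ℂ} (hA : ∀ i, (A i).PosSemidef)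
    (hB : ∀ j, (B j).PosSemidef) (h : (∑ i, A i) * (∑ j, B j) = 0) (i : ι) (j : κ) :
    A i * B j = 0 := by
  have hnonneg (i) (j) : 0 ≤ (A i * B j).trace := trace_mul_nonneg (hA i) (hB j)
  have hsum : ∑ i, ∑ j, (A i * B j).trace = 0 := by
    simp only [← trace_sum, ← Finset.mul_sum, ← Finset.sum_mul, h, trace_zero]
  rw [Fintype.sum_eq_zero_iff_of_nonneg fun i => Finset.sum_nonneg fun j _ => hnonneg i j] at hsum
  have hsum_i := (Fintype.sum_eq_zero_iff_of_nonneg (hnonneg i)).1 (congrFun hsum i)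
  exact (trace_mul_eq_zero_iff (hA i) (hB j)).1 (congrFun hsum_i j)

theorem trace_conjTranspose_mul_mul_eq_zero {n : Type*} [Fintype n] {A B ρ : Matrix n n ℂ}
    (hρ : ρ.PosSemidef) (h : (A * ρ * Aᴴ) * (B * ρ * Bᴴ) = 0) : (Aᴴ * B * ρ).trace = 0 := by
  obtain ⟨R, rfl⟩ := exists_eq_mul_conjTranspose hρ
  have hAB : (A * R) * (A * R)ᴴ * ((B * R) * (B * R)ᴴ) = 0 := by
    simpa only [conjTranspose_mul, Matrix.mul_assoc] using h
  rw [mul_self_mul_conjTranspose_eq_zero, self_mul_conjTranspose_mul_eq_zero] at hAB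
  calc (Aᴴ * B * (R * Rᴴ)).trace = ((A * R)ᴴ * (B * R)).trace := by
        rw [← Matrix.mul_assoc, trace_mul_comm, conjTranspose_mul]
        simp only [Matrix.mul_assoc]
    _ = 0 := by rw [hAB, trace_zero]

theorem vecMulVec_mul_mul_vecMulVec {n : Type*} [Fintype n] (u v : n → ℂ) (A : Matrix n n ℂ) :
    vecMulVec u v * A * vecMulVec u v = (A * vecMulVec u v).trace • vecMulVec u v := by
  rw [Matrix.mul_assoc, mul_vecMulVec, vecMulVec_mul_vecMulVec, trace_vecMulVec, dotProduct_comm,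
    vecMulVec_smul]

variable {d M : ℕ} {κ : Fin M → Type*} [∀ m, Fintype (κ m)]
  {K : ∀ m, κ m → Matrix (Fin d) (Fin d) ℂ}

theorem perfectlyDistinguishable_iff {Φ : Fin M → Superop d} (hΦ : ∀ m, IsChannel (Φ m)) :
    PerfectlyDistinguishable Φ ↔ M ≠ 0 ∧
      ∃ (r : ℕ) (ρ : Matrix (Fin d × Fin r) (Fin d × Fin r) ℂ), IsState ρ ∧
        Pairwise fun m n => ampliate (Φ m) r ρ * ampliate (Φ n) r ρ = 0 := by
  constructor
  · rintro ⟨r, ρ, E, hρ, hE, hsucc⟩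
    have hM : M ≠ 0 := by
      rintro rfl
      simp [successProb] at hsucc
    exact ⟨hM, r, ρ, hρ, (exists_isPOVM_iff_pairwise_mul_eq_zero hM
      fun m => hρ.ampliate (hΦ m)).1 ⟨E, hE, hsucc⟩⟩
  · rintro ⟨hM, r, ρ, hρ, horth⟩
    obtain ⟨E, hE, hsucc⟩ := (exists_isPOVM_iff_pairwise_mul_eq_zero hM
      fun m => hρ.ampliate (hΦ m)).2 horth
    exact ⟨r, ρ, E, hρ, hE, hsucc⟩

theorem exists_trace_eq_zero_of_perfectlyDistinguishable
    (hK : ∀ m, ∑ j, (K m j)ᴴ * K m j = 1)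
    (h : PerfectlyDistinguishable fun m => krausMap (K m)) :
    ∃ S, IsState S ∧ ∀ m n, m ≠ n → ∀ i j, ((K m i)ᴴ * K n j * S).trace = 0 := by
  obtain ⟨-, r, ρ, hρ, horth⟩ :=
    (perfectlyDistinguishable_iff fun m => isChannel_krausMap_iff.2 (hK m)).1 h
  refine ⟨partialTrace ρ, hρ.partialTrace, fun m n hmn i j => ?_⟩
  have hmul := horth hmn
  simp only [ampliate_krausMap] at hmul
  have hij := mul_eq_zero_of_sum_mul_sum_eq_zero
    (fun _ => hρ.posSemidef.mul_mul_conjTranspose_same _)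
    (fun _ => hρ.posSemidef.mul_mul_conjTranspose_same _) hmul i j
  rw [← trace_kronecker_one_mul, ← Matrix.one_mul (1 : Matrix (Fin r) (Fin r) ℂ),
    mul_kronecker_mul]
  simpa [conjTranspose_kronecker] using trace_conjTranspose_mul_mul_eq_zero hρ.posSemidef hij

theorem perfectlyDistinguishable_krausMap (hM : M ≠ 0) (hK : ∀ m, ∑ j, (K m j)ᴴ * K m j = 1)
    {S : Matrix (Fin d) (Fin d) ℂ} (hS : IsState S)
    (hKS : ∀ m n, m ≠ n → ∀ i j, ((K m i)ᴴ * K n j * S).trace = 0) :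
    PerfectlyDistinguishable fun m => krausMap (K m) := by
  obtain ⟨ψ, hψ, rfl⟩ := exists_pure_partialTrace_eq hS
  refine (perfectlyDistinguishable_iff fun m => isChannel_krausMap_iff.2 (hK m)).2
    ⟨hM, d, vecMulVec ψ (star ψ), hψ, fun m n hmn => ?_⟩
  set ρ := vecMulVec ψ (star ψ) with hρ
  simp only [ampliate_krausMap, Finset.sum_mul_sum]
  refine Finset.sum_eq_zero fun i _ => Finset.sum_eq_zero fun j _ => ?_
  let A := K m i ⊗ₖ (1 : Matrix (Fin d) (Fin d) ℂ)
  let B := K n j ⊗ₖ (1 : Matrix (Fin d) (Fin d) ℂ)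
  have hAB : ρ * (Aᴴ * B) * ρ = 0 := by
    rw [hρ, vecMulVec_mul_mul_vecMulVec, conjTranspose_kronecker, ← mul_kronecker_mul,
      conjTranspose_one, Matrix.one_mul, trace_kronecker_one_mul, hKS m n hmn, zero_smul]
  calc A * ρ * Aᴴ * (B * ρ * Bᴴ) = A * (ρ * (Aᴴ * B) * ρ) * Bᴴ := by
        simp only [Matrix.mul_assoc]
    _ = 0 := by rw [hAB, Matrix.mul_zero, Matrix.zero_mul]

/-- A certificate that the channels with Kraus operators `K m` have classical action `T` and are
perfectly distinguishable: Kraus operators of different channels are orthogonal for the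
semi-inner product `tr (Aᴴ B S)`. The density matrix `S` is the reduced state on the system of the
input of a distinguishing protocol. -/
structure IsOrthogonalKraus (T : Matrix (Fin d) (Fin d) ℝ)
    (K : ∀ m, κ m → Matrix (Fin d) (Fin d) ℂ) (S : Matrix (Fin d) (Fin d) ℂ) : Prop where
  sum_conjTranspose_mul : ∀ m, ∑ j, (K m j)ᴴ * K m j = 1
  sum_norm_sq : ∀ m k l, ∑ j, ‖K m j k l‖ ^ 2 = T k l
  isState : IsState S
  trace_eq_zero : ∀ m n, m ≠ n → ∀ i j, ((K m i)ᴴ * K n j * S).trace = 0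

variable {T : Matrix (Fin d) (Fin d) ℝ} {S : Matrix (Fin d) (Fin d) ℂ}

theorem IsOrthogonalKraus.mem_distinguishableCounts (h : IsOrthogonalKraus T K S) (hM : M ≠ 0) :
    M ∈ distinguishableCounts T :=
  ⟨fun m => krausMap (K m), fun m => isChannel_krausMap_iff.2 (h.sum_conjTranspose_mul m),
    fun m => hasClassicalAction_krausMap_iff.2 (h.sum_norm_sq m),
    perfectlyDistinguishable_krausMap hM h.sum_conjTranspose_mul h.isState h.trace_eq_zero⟩

theorem ne_zero_of_mem_distinguishableCounts (h : M ∈ distinguishableCounts T) : M ≠ 0 := by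
  obtain ⟨Φ, hΦ, -, hdist⟩ := h
  exact ((perfectlyDistinguishable_iff hΦ).1 hdist).1

theorem exists_isOrthogonalKraus (h : M ∈ distinguishableCounts T) :
    ∃ (s : Fin M → ℕ) (K : ∀ m, Fin (s m) → Matrix (Fin d) (Fin d) ℂ)
      (S : Matrix (Fin d) (Fin d) ℂ), IsOrthogonalKraus T K S := by
  obtain ⟨Φ, hΦ, hT, hdist⟩ := h
  choose s K hΦK using fun m => exists_eq_krausMap (hΦ m).completelyPositive
  obtain rfl : Φ = fun m => krausMap (K m) := funext hΦK
  have hK m := isChannel_krausMap_iff.1 (hΦ m)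
  obtain ⟨S, hS, hKS⟩ := exists_trace_eq_zero_of_perfectlyDistinguishable hK hdist
  exact ⟨s, K, S, hK, fun m => hasClassicalAction_krausMap_iff.1 (hT m), hS, hKS⟩

end Distinguishability

section KrausSpans

theorem trace_eq_zero_of_mem_span {m n ι κ : Type*} [Fintype m] [Fintype n]
    {A : ι → Matrix m n ℂ} {B : κ → Matrix m n ℂ} {S : Matrix n n ℂ}
    (h : ∀ i j, ((A i)ᴴ * B j * S).trace = 0) {x y : Matrix m n ℂ}
    (hx : x ∈ Submodule.span ℂ (Set.range A)) (hy : y ∈ Submodule.span ℂ (Set.range B)) :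
    (xᴴ * y * S).trace = 0 := by
  induction hx using Submodule.span_induction with
  | zero => simp
  | add x x' _ _ hx hx' => simp [Matrix.add_mul, hx, hx']
  | smul c x _ hx => simp [hx]
  | mem x hx =>
    obtain ⟨i, rfl⟩ := hx
    induction hy using Submodule.span_induction with
    | zero => simp
    | add y y' _ _ hy hy' => simp [Matrix.add_mul, Matrix.mul_add, hy, hy']
    | smul c y _ hy => simp [hy]
    | mem y hy =>
      obtain ⟨j, rfl⟩ := hy
      exact h i j

theorem iSupIndep_map_mulRightLinearMap {m n ι : Type*} [Fintype m] [Fintype n]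
    {S : Matrix n n ℂ} (hS : S.PosSemidef) {V : ι → Submodule ℂ (Matrix m n ℂ)}
    (hV : ∀ i j, i ≠ j → ∀ x ∈ V i, ∀ y ∈ V j, (xᴴ * y * S).trace = 0) :
    iSupIndep fun i => (V i).map (mulRightLinearMap m ℂ S) := by
  classical
  rw [iSupIndep_iff_finsetSum_eq_zero_imp_eq_zero]
  intro s v hv hsum i hi
  choose! x hxV hxv using hv
  have htrace : ((x i)ᴴ * (x i) * S).trace = 0 := by
    calc ((x i)ᴴ * (x i) * S).trace = ∑ j ∈ s, ((x i)ᴴ * x j * S).trace :=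
          (Finset.sum_eq_single_of_mem i hi
            fun j hj hji => hV i j hji.symm _ (hxV i hi) _ (hxV j hj)).symm
      _ = ((x i)ᴴ * ∑ j ∈ s, v j).trace := by
          rw [Matrix.mul_sum, trace_sum]
          exact Finset.sum_congr rfl fun j hj => by
            rw [← hxv j hj, mulRightLinearMap_apply, Matrix.mul_assoc]
      _ = 0 := by rw [hsum, Matrix.mul_zero, trace_zero]
  rw [trace_mul_eq_zero_iff (posSemidef_conjTranspose_mul_self _) hS,
    conjTranspose_mul_self_mul_eq_zero] at htrace
  rw [← hxv i hi, mulRightLinearMap_apply, htrace]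

theorem finrank_iSup_of_iSupIndep {F W ι : Type*} [Field F] [AddCommGroup W] [Module F W]
    [FiniteDimensional F W] [Fintype ι] {V : ι → Submodule F W} (hV : iSupIndep V) :
    Module.finrank F (⨆ i, V i : Submodule F W) = ∑ i, Module.finrank F (V i) := by
  classical
  rw [Submodule.iSup_eq_range_dfinsupp_lsum,
    LinearMap.finrank_range_of_inj hV.dfinsupp_lsum_injective]
  exact Module.finrank_directSum F fun i => V i

theorem finrank_range_mulRightLinearMap_le {l m n F : Type*} [Fintype l] [Fintype m] [Fintype n]
    [Field F] (S : Matrix m n F) :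
    Module.finrank F (LinearMap.range (mulRightLinearMap l F S)) ≤ Fintype.card l * S.rank := by
  let incl : (l → Submodule.span F (Set.range S.row)) →ₗ[F] Matrix l n F :=
    (Submodule.span F (Set.range S.row)).subtype.compLeft l
  have hle : LinearMap.range (mulRightLinearMap l F S) ≤ LinearMap.range incl := by
    rintro _ ⟨A, rfl⟩
    refine ⟨fun i => ⟨A i ᵥ* S, ?_⟩, rfl⟩
    rw [← range_vecMulLinear]
    exact ⟨A i, rfl⟩
  calc Module.finrank F (LinearMap.range (mulRightLinearMap l F S))
      ≤ Module.finrank F (LinearMap.range incl) := Submodule.finrank_mono hle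
    _ ≤ Module.finrank F (l → Submodule.span F (Set.range S.row)) := LinearMap.finrank_range_le _
    _ = Fintype.card l * S.rank := by
      rw [Module.finrank_pi_fintype, Finset.sum_const, ← rank_eq_finrank_span_row, smul_eq_mul,
        Finset.card_univ]

theorem isUnit_of_rank_eq_card {n F : Type*} [Fintype n] [DecidableEq n] [Field F]
    {S : Matrix n n F} (hS : S.rank = Fintype.card n) : IsUnit S := by
  rw [← linearIndependent_rows_iff_isUnit, linearIndependent_iff_card_eq_finrank_span, ← hS,
    rank_eq_finrank_span_row]
  rfl

theorem finrank_map_mulRightLinearMap {m n F : Type*} [Fintype n] [DecidableEq n] [Field F]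
    {S : Matrix n n F} (hS : IsUnit S) (V : Submodule F (Matrix m n F)) :
    Module.finrank F (V.map (mulRightLinearMap m F S)) = Module.finrank F V := by
  obtain ⟨S, rfl⟩ := hS
  refine (Submodule.equivMapOfInjective _ (fun A B hAB => ?_) V).finrank_eq.symm
  simpa [Matrix.mul_assoc] using congrArg (· * (S⁻¹ : (Matrix n n F)ˣ).val) hAB

variable {d M : ℕ} {κ : Fin M → Type*} [∀ m, Fintype (κ m)]
  {K : ∀ m, κ m → Matrix (Fin d) (Fin d) ℂ} {T : Matrix (Fin d) (Fin d) ℝ}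
  {S : Matrix (Fin d) (Fin d) ℂ}

theorem IsOrthogonalKraus.sum_finrank_map_le (h : IsOrthogonalKraus T K S) :
    ∑ m, Module.finrank ℂ ((Submodule.span ℂ (Set.range (K m))).map
      (mulRightLinearMap (Fin d) ℂ S)) ≤ d * S.rank := by
  have hindep := iSupIndep_map_mulRightLinearMap h.isState.posSemidef fun m n hmn x hx y hy =>
    trace_eq_zero_of_mem_span (h.trace_eq_zero m n hmn) hx hy
  rw [← finrank_iSup_of_iSupIndep hindep]
  calc _ ≤ Module.finrank ℂ (LinearMap.range (mulRightLinearMap (Fin d) ℂ S)) :=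
        Submodule.finrank_mono (iSup_le fun _ => LinearMap.map_le_range)
    _ ≤ d * S.rank := by simpa using finrank_range_mulRightLinearMap_le (l := Fin d) S

theorem IsOrthogonalKraus.one_le_finrank_map (h : IsOrthogonalKraus T K S) (m : Fin M) :
    1 ≤ Module.finrank ℂ ((Submodule.span ℂ (Set.range (K m))).map
      (mulRightLinearMap (Fin d) ℂ S)) := by
  rw [Submodule.one_le_finrank_iff]
  intro hbot
  have hKS (j : κ m) : K m j * S = 0 := by
    rw [← Submodule.mem_bot ℂ, ← hbot, ← mulRightLinearMap_apply (R := ℂ)]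
    exact Submodule.mem_map_of_mem (Submodule.subset_span ⟨j, rfl⟩)
  have hS : S = 0 := by
    calc S = ∑ j, (K m j)ᴴ * (K m j * S) := by
          simp only [← Matrix.mul_assoc, ← Finset.sum_mul, h.sum_conjTranspose_mul,
            Matrix.one_mul]
      _ = 0 := by simp only [hKS, Matrix.mul_zero, Finset.sum_const_zero]
  simpa [hS] using h.isState.trace_eq_one

theorem IsOrthogonalKraus.card_le_mul_rank (h : IsOrthogonalKraus T K S) : M ≤ d * S.rank :=
  calc M = ∑ _m : Fin M, 1 := by simp
    _ ≤ _ := Finset.sum_le_sum fun m _ => h.one_le_finrank_map m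
    _ ≤ d * S.rank := h.sum_finrank_map_le

theorem IsOrthogonalKraus.isUnit_of_lt (h : IsOrthogonalKraus T K S) (hM : d * (d - 1) < M) :
    IsUnit S := by
  have hrank : d - 1 < S.rank := lt_of_mul_lt_mul_left' (hM.trans_le h.card_le_mul_rank)
  refine isUnit_of_rank_eq_card ?_
  have := S.rank_le_height
  rw [Fintype.card_fin]
  omega

theorem exists_unitary_of_finrank_span_le_one {n ι : Type*} [Fintype n] [DecidableEq n] [Fintype ι]
    {K : ι → Matrix n n ℂ} (hK : ∑ j, (K j)ᴴ * K j = 1)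
    (h : Module.finrank ℂ (Submodule.span ℂ (Set.range K)) ≤ 1) :
    ∃ U ∈ Submodule.span ℂ (Set.range K), Uᴴ * U = 1 ∧
      ∀ k l, ‖U k l‖ ^ 2 = ∑ j, ‖K j k l‖ ^ 2 := by
  obtain ⟨⟨V, hV⟩, hVspan⟩ := finrank_le_one_iff.1 h
  choose c hc using fun j => hVspan ⟨K j, Submodule.subset_span ⟨j, rfl⟩⟩
  have hKV (j : ι) : K j = c j • V := (congrArg Subtype.val (hc j)).symm
  set t : ℝ := ∑ j, ‖c j‖ ^ 2
  have ht : √t ^ 2 = t := Real.sq_sqrt (Finset.sum_nonneg fun j _ => sq_nonneg _)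
  refine ⟨((√t : ℝ) : ℂ) • V, Submodule.smul_mem _ _ hV, ?_, fun k l => ?_⟩
  · calc (((√t : ℝ) : ℂ) • V)ᴴ * (((√t : ℝ) : ℂ) • V) = ((√t ^ 2 : ℝ) : ℂ) • (Vᴴ * V) := by
          rw [conjTranspose_smul, smul_mul_smul_comm, Complex.star_def, Complex.conj_ofReal,
            Complex.ofReal_pow, sq]
      _ = ∑ j, (K j)ᴴ * K j := by
          simp [ht, t, hKV, smul_smul, Complex.mul_conj', Finset.sum_smul]
      _ = 1 := hK
  · simp [hKV, mul_pow, ht, ← Finset.sum_mul, t]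

theorem IsOrthogonalKraus.sum_finrank_span_le (h : IsOrthogonalKraus T K S)
    (hM : d * (d - 1) < M) :
    ∑ m, Module.finrank ℂ (Submodule.span ℂ (Set.range (K m))) ≤ d ^ 2 := by
  have hle := h.sum_finrank_map_le
  simp only [finrank_map_mulRightLinearMap (h.isUnit_of_lt hM)] at hle
  calc _ ≤ d * S.rank := hle
    _ ≤ d ^ 2 := by rw [sq]; gcongr; exact S.rank_le_height

theorem IsOrthogonalKraus.one_le_finrank_span (h : IsOrthogonalKraus T K S) (m : Fin M) :
    1 ≤ Module.finrank ℂ (Submodule.span ℂ (Set.range (K m))) :=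
  (h.one_le_finrank_map m).trans (Submodule.finrank_map_le _ _)

theorem IsOrthogonalKraus.exists_finrank_span_le_one (h : IsOrthogonalKraus T K S)
    (hM : d * (d - 1) < M) :
    ∃ m, Module.finrank ℂ (Submodule.span ℂ (Set.range (K m))) ≤ 1 := by
  by_contra! hall
  have hsum : M * 2 ≤ d ^ 2 :=
    calc M * 2 = ∑ _m : Fin M, 2 := by simp
      _ ≤ _ := Finset.sum_le_sum fun m _ => hall m
      _ ≤ d ^ 2 := h.sum_finrank_span_le hM
  obtain _ | e := d
  · omega
  · rw [Nat.add_sub_cancel] at hM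
    nlinarith

theorem IsOrthogonalKraus.finrank_span_le_one (h : IsOrthogonalKraus T K S) (hM : d ^ 2 ≤ M)
    (m : Fin M) : Module.finrank ℂ (Submodule.span ℂ (Set.range (K m))) ≤ 1 := by
  have hlt : d * (d - 1) < M := by
    obtain _ | e := d
    · simpa using m.pos
    · rw [Nat.add_sub_cancel]
      nlinarith
  have hone (m) (_ : m ∈ Finset.univ) := h.one_le_finrank_span m
  have hsum : ∑ m, Module.finrank ℂ (Submodule.span ℂ (Set.range (K m))) ≤ ∑ _m : Fin M, 1 := by
    simpa using (h.sum_finrank_span_le hlt).trans hM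
  exact ((Finset.sum_eq_sum_iff_of_le hone).1
    ((Finset.sum_le_sum hone).antisymm hsum) m (Finset.mem_univ m)).ge

end KrausSpans

section UpperBounds

theorem conjTranspose_mul_rows_mul_eq_one {n ι : Type*} [Fintype n] [DecidableEq n] [Fintype ι]
    [DecidableEq ι] (hcard : Fintype.card ι = Fintype.card n * Fintype.card n)
    {U : ι → Matrix n n ℂ} {S : Matrix n n ℂ}
    (hU : ∀ i j, ((U i)ᴴ * U j * S).trace = if i = j then 1 else 0) (k : n) :
    (Matrix.of fun i l => U i k l)ᴴ * (Matrix.of fun i l => U i k l) * S = 1 := by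
  let A : Matrix ι (n × n) ℂ := Matrix.of fun i p => U i p.1 p.2
  let R : Matrix ι (n × n) ℂ := Matrix.of fun i p => (U i * S) p.1 p.2
  have hRA : R * Aᴴ = 1 := by
    ext i j
    rw [one_apply, ← if_congr eq_comm rfl rfl, ← hU, Matrix.mul_assoc]
    simp only [R, A, mul_apply, of_apply, conjTranspose_apply, trace, diag_apply,
      Fintype.sum_prod_type_right, mul_comm]
  have hAR : Aᴴ * R = 1 := (mul_eq_one_comm_of_card_eq _ _ _ (by simpa using hcard)).1 hRA
  ext j l
  have hjl := congrFun₂ hAR (k, j) (k, l)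
  rw [Matrix.mul_assoc, mul_apply]
  simpa [R, A, mul_apply, one_apply] using hjl

theorem sum_norm_sq_eq_of_trace_orthogonal {n ι : Type*} [Fintype n] [Fintype ι] [DecidableEq ι]
    (hcard : Fintype.card ι = Fintype.card n * Fintype.card n)
    {U : ι → Matrix n n ℂ} {S : Matrix n n ℂ}
    (hU : ∀ i j, ((U i)ᴴ * U j * S).trace = if i = j then 1 else 0) (k k' l : n) :
    ∑ i, ‖U i k l‖ ^ 2 = ∑ i, ‖U i k' l‖ ^ 2 := by
  classical
  have hrows (k : n) := conjTranspose_mul_rows_mul_eq_one hcard hU k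
  have hgram : (Matrix.of fun i l => U i k l)ᴴ * (Matrix.of fun i l => U i k l) =
      (Matrix.of fun i l => U i k' l)ᴴ * (Matrix.of fun i l => U i k' l) :=
    left_inv_eq_left_inv (hrows k) (hrows k')
  have hll := congrFun₂ hgram l l
  simp only [mul_apply, conjTranspose_apply, of_apply, Complex.star_def, Complex.conj_mul'] at hll
  exact_mod_cast hll

theorem sum_norm_sq_row_eq_one {m n : Type*} [Fintype n] [DecidableEq m] {A : Matrix m n ℂ}
    (hA : A * Aᴴ = 1) (k : m) : ∑ l, ‖A k l‖ ^ 2 = 1 := by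
  have hkk := congrFun₂ hA k k
  simp only [mul_apply, conjTranspose_apply, Complex.star_def, Complex.mul_conj',
    one_apply_eq] at hkk
  exact_mod_cast hkk

variable {d M : ℕ} {T : Matrix (Fin d) (Fin d) ℝ}

theorem le_sq_of_mem_distinguishableCounts (h : M ∈ distinguishableCounts T) : M ≤ d ^ 2 := by
  obtain ⟨s, K, S, hKS⟩ := exists_isOrthogonalKraus h
  calc M ≤ d * S.rank := hKS.card_le_mul_rank
    _ ≤ d ^ 2 := by rw [sq]; gcongr; exact S.rank_le_height

theorem sum_row_eq_one_of_mem_distinguishableCounts (h : M ∈ distinguishableCounts T)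
    (hM : d * (d - 1) < M) (k : Fin d) : ∑ l, T k l = 1 := by
  obtain ⟨s, K, S, hKS⟩ := exists_isOrthogonalKraus h
  obtain ⟨m, hm⟩ := hKS.exists_finrank_span_le_one hM
  obtain ⟨U, -, hU, hUK⟩ :=
    exists_unitary_of_finrank_span_le_one (hKS.sum_conjTranspose_mul m) hm
  rw [← sum_norm_sq_row_eq_one (mul_eq_one_comm.1 hU) k]
  exact Finset.sum_congr rfl fun l _ => by rw [hUK, hKS.sum_norm_sq]

theorem apply_eq_inv_of_sq_mem_distinguishableCounts (h : d ^ 2 ∈ distinguishableCounts T)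
    (k l : Fin d) : T k l = (d : ℝ)⁻¹ := by
  obtain ⟨s, K, S, hKS⟩ := exists_isOrthogonalKraus h
  choose U hUspan hU hUK using fun m => exists_unitary_of_finrank_span_le_one
    (hKS.sum_conjTranspose_mul m) (hKS.finrank_span_le_one le_rfl m)
  have hUT (m) (k) (l) : ‖U m k l‖ ^ 2 = T k l := (hUK m k l).trans (hKS.sum_norm_sq m k l)
  have horth (m n) : ((U m)ᴴ * U n * S).trace = if m = n then 1 else 0 := by
    split_ifs with hmn
    · rw [hmn, hU, Matrix.one_mul, hKS.isState.trace_eq_one]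
    · exact trace_eq_zero_of_mem_span (hKS.trace_eq_zero m n hmn) (hUspan m) (hUspan n)
  have hd : (d : ℝ) ≠ 0 := Nat.cast_ne_zero.2 k.pos.ne'
  have hconst (k' : Fin d) : T k' l = T k l := by
    have hsum := sum_norm_sq_eq_of_trace_orthogonal (by simp [sq]) horth k' k l
    simpa [hUT, hd] using hsum
  have hcol : ∑ k', T k' l = 1 := by
    have hUl := sum_norm_sq_row_eq_one (A := (U ⟨0, by have := k.pos; positivity⟩)ᴴ)
      (by rw [conjTranspose_conjTranspose, hU]) l
    simpa [hUT] using hUl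
  rw [Finset.sum_congr rfl fun k' _ => hconst k', Finset.sum_const, Finset.card_univ,
    Fintype.card_fin, nsmul_eq_mul] at hcol
  exact eq_inv_of_mul_eq_one_right hcol

end UpperBounds

section LowerBounds

variable {d M : ℕ} {T : Matrix (Fin d) (Fin d) ℝ}

theorem isState_inv_smul_one (n : Type*) [Fintype n] [DecidableEq n] [Nonempty n] :
    IsState ((Fintype.card n : ℂ)⁻¹ • (1 : Matrix n n ℂ)) :=
  ⟨PosSemidef.one.smul (by positivity), by simp⟩

theorem mem_distinguishableCounts_of_unitaries [NeZero d] (hM : M ≠ 0)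
    {U : Fin M → Matrix (Fin d) (Fin d) ℂ} (hU : ∀ m, (U m)ᴴ * U m = 1)
    (hT : ∀ m k l, ‖U m k l‖ ^ 2 = T k l)
    (horth : ∀ m n, m ≠ n → ((U m)ᴴ * U n).trace = 0) : M ∈ distinguishableCounts T := by
  have h : IsOrthogonalKraus T (fun m (_ : Unit) => U m)
      ((Fintype.card (Fin d) : ℂ)⁻¹ • 1) := by
    refine ⟨fun m => ?_, fun m k l => ?_, isState_inv_smul_one _, fun m n hmn _ _ => ?_⟩
    · rw [Fintype.sum_unique, hU]
    · rw [Fintype.sum_unique, hT]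
    · rw [Matrix.mul_smul, Matrix.mul_one, trace_smul, horth m n hmn, smul_zero]
  exact h.mem_distinguishableCounts hM

theorem mem_distinguishableCounts_of_phases {ι : Type*} [Fintype ι] (hM : M ≠ 0)
    {K : ι → Matrix (Fin d) (Fin d) ℂ} (hK : ∑ j, (K j)ᴴ * K j = 1)
    (hT : ∀ k l, ∑ j, ‖K j k l‖ ^ 2 = T k l) {z : Fin M → Fin d → ℂ}
    (hz : ∀ m k, ‖z m k‖ = 1) {S : Matrix (Fin d) (Fin d) ℂ} (hS : IsState S)
    (horth : ∀ m n, m ≠ n → ∀ i j,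
      ((K i)ᴴ * diagonal (star (z m) * z n) * K j * S).trace = 0) :
    M ∈ distinguishableCounts T := by
  have hmul (m n) (i j : ι) : (diagonal (z m) * K i)ᴴ * (diagonal (z n) * K j) =
      (K i)ᴴ * diagonal (star (z m) * z n) * K j := by
    rw [conjTranspose_mul, diagonal_conjTranspose, Matrix.mul_assoc,
      ← Matrix.mul_assoc (diagonal _), diagonal_mul_diagonal', ← Matrix.mul_assoc]
    rfl
  have hzz (m) : star (z m) * z m = 1 := by
    ext k
    simp [Complex.conj_mul', hz]
  have h : IsOrthogonalKraus T (fun m j => diagonal (z m) * K j) S := by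
    refine ⟨fun m => ?_, fun m k l => ?_, hS, fun m n hmn i j => ?_⟩
    · simpa only [hmul, hzz, diagonal_one', Matrix.mul_one] using hK
    · simpa only [diagonal_mul, norm_mul, hz, one_mul] using hT k l
    · rw [hmul, horth m n hmn]
  exact h.mem_distinguishableCounts hM

theorem mem_distinguishableCounts_submatrix (σ : Equiv.Perm (Fin d))
    (h : M ∈ distinguishableCounts T) : M ∈ distinguishableCounts (T.submatrix σ id) := by
  obtain ⟨s, K, S, hKS⟩ := exists_isOrthogonalKraus h
  have hmul (A B : Matrix (Fin d) (Fin d) ℂ) :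
      (A.submatrix σ id)ᴴ * B.submatrix σ id = Aᴴ * B := by
    rw [conjTranspose_submatrix, submatrix_mul_equiv, submatrix_id_id]
  have hσ : IsOrthogonalKraus (T.submatrix σ id) (fun m j => (K m j).submatrix σ id) S := by
    refine ⟨fun m => ?_, fun m k l => hKS.sum_norm_sq m (σ k) l, hKS.isState,
      fun m n hmn i j => ?_⟩
    · simpa only [hmul] using hKS.sum_conjTranspose_mul m
    · rw [hmul, hKS.trace_eq_zero m n hmn]
  exact hσ.mem_distinguishableCounts (ne_zero_of_mem_distinguishableCounts h)

end LowerBounds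

section Quaternions

/-- The matrix model of the quaternions (with one imaginary unit negated): it sends the unit
sphere of `ℝ⁴` onto `SU(2)`, and the first two coordinates form the diagonal entry. -/
def quaternionMatrix (v : Fin 4 → ℝ) : Matrix (Fin 2) (Fin 2) ℂ :=
  !![⟨v 0, v 1⟩, ⟨-v 2, v 3⟩; ⟨v 2, v 3⟩, ⟨v 0, -v 1⟩]

theorem quaternionMatrix_conjTranspose_mul_self (v : Fin 4 → ℝ) :
    (quaternionMatrix v)ᴴ * quaternionMatrix v = ((v ⬝ᵥ v : ℝ) : ℂ) • 1 := by
  ext i j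
  fin_cases i <;> fin_cases j <;> apply Complex.ext <;>
    simp [quaternionMatrix, mul_apply, dotProduct, Fin.sum_univ_four] <;> ring

theorem trace_quaternionMatrix_conjTranspose_mul (u v : Fin 4 → ℝ) :
    ((quaternionMatrix u)ᴴ * quaternionMatrix v).trace = ((2 * (u ⬝ᵥ v) : ℝ) : ℂ) := by
  apply Complex.ext <;>
    simp [quaternionMatrix, trace_fin_two, mul_apply, dotProduct, Fin.sum_univ_four] <;> ring

theorem norm_sq_quaternionMatrix {v : Fin 4 → ℝ} (hv : v ⬝ᵥ v = 1) (k l : Fin 2) :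
    ‖quaternionMatrix v k l‖ ^ 2 =
      qubitAction (v 0 ^ 2 + v 1 ^ 2) (v 0 ^ 2 + v 1 ^ 2) k l := by
  simp only [dotProduct, Fin.sum_univ_four] at hv
  fin_cases k <;> fin_cases l <;>
    simp [quaternionMatrix, qubitAction, ← Complex.normSq_eq_norm_sq, Complex.normSq_apply] <;>
    linarith

theorem mem_distinguishableCounts_of_quaternions {M : ℕ} (hM : M ≠ 0) {a : ℝ}
    {v : Fin M → Fin 4 → ℝ} (hv : ∀ m n, v m ⬝ᵥ v n = if m = n then 1 else 0)
    (ha : ∀ m, v m 0 ^ 2 + v m 1 ^ 2 = a) :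
    M ∈ distinguishableCounts (qubitAction a a) := by
  have hone (m) : v m ⬝ᵥ v m = 1 := by simp [hv]
  refine mem_distinguishableCounts_of_unitaries hM (U := fun m => quaternionMatrix (v m))
    (fun m => ?_) (fun m k l => ?_) fun m n hmn => ?_
  · rw [quaternionMatrix_conjTranspose_mul_self, hone, Complex.ofReal_one, one_smul]
  · rw [norm_sq_quaternionMatrix (hone m), ha]
  · simp [trace_quaternionMatrix_conjTranspose_mul, hv, hmn]

theorem four_mem_distinguishableCounts :
    4 ∈ distinguishableCounts (qubitAction (1 / 2) (1 / 2)) := by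
  obtain ⟨r, hr⟩ : ∃ r : ℝ, r ^ 2 = 1 / 2 := ⟨√(1 / 2), Real.sq_sqrt (by norm_num)⟩
  refine mem_distinguishableCounts_of_quaternions four_ne_zero
    (v := ![![r, 0, r, 0], ![r, 0, -r, 0], ![0, r, 0, r], ![0, r, 0, -r]])
    (fun m n => ?_) fun m => ?_
  · fin_cases m <;> fin_cases n <;> simp [dotProduct, Fin.sum_univ_four, ← sq, hr] <;> norm_num
  · fin_cases m <;> simp [hr]

theorem three_mem_distinguishableCounts {a : ℝ} (ha : a ∈ Set.Icc (1 / 3 : ℝ) (2 / 3)) :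
    3 ∈ distinguishableCounts (qubitAction a a) := by
  obtain ⟨h1, h2⟩ := ha
  have exists_sq {r : ℝ} (hr : 0 ≤ r) : ∃ x, x ^ 2 = r := ⟨√r, Real.sq_sqrt hr⟩
  obtain ⟨p, hp⟩ : ∃ p : ℝ, p ^ 2 = (1 - a) / 2 := exists_sq (by linarith)
  obtain ⟨q, hq⟩ : ∃ q : ℝ, q ^ 2 = a / 2 := exists_sq (by linarith)
  obtain ⟨x, hx⟩ : ∃ x : ℝ, x ^ 2 = (3 * a - 1) / 2 := exists_sq (by linarith)
  obtain ⟨y, hy⟩ : ∃ y : ℝ, y ^ 2 = (2 - 3 * a) / 2 := exists_sq (by linarith)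
  obtain ⟨t, ht⟩ : ∃ t : ℝ, t ^ 2 = 2 := exists_sq (by norm_num)
  have hself : p * p + x * x + q * q + y * y = 1 := by linarith
  have hpair : p * p - x * x + q * q - y * y = 0 := by linarith
  have hthird : t * q * (t * q) + t * p * (t * p) = 1 := by
    linear_combination (q ^ 2 + p ^ 2) * ht + 2 * hp + 2 * hq
  -- The first two vectors differ by the signs of coordinates 1 and 3, and the third is orthogonal
  -- to both; the condition on coordinates 0 and 1 then determines `p`, `q`, `x` and `y`.
  refine mem_distinguishableCounts_of_quaternions three_ne_zero
    (v := ![![p, x, q, y], ![p, -x, q, -y], ![t * q, 0, -(t * p), 0]])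
    (fun m n => ?_) fun m => ?_
  · fin_cases m <;> fin_cases n <;> simp [dotProduct, Fin.sum_univ_four] <;>
      linarith [hself, hpair, hthird]
  · fin_cases m <;> simp
    · linear_combination hp + hx
    · linear_combination hp + hx
    · linear_combination q ^ 2 * ht + 2 * hq

end Quaternions

section TwoChannels

theorem exists_unit_vector_component_eq {t x y : ℝ} (h : t ^ 2 ≤ x ^ 2 + y ^ 2) :
    ∃ c s m : ℝ, c ^ 2 + s ^ 2 = 1 ∧ x = t * c - m * s ∧ y = t * s + m * c := by
  rcases eq_or_ne (x ^ 2 + y ^ 2) 0 with hxy | hxy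
  · have hx : x = 0 := by nlinarith
    have hy : y = 0 := by nlinarith
    have ht : t = 0 := by nlinarith
    exact ⟨1, 0, 0, by norm_num, by simp [hx, ht], by simp [hy]⟩
  · obtain ⟨m, hm⟩ : ∃ m : ℝ, m ^ 2 = x ^ 2 + y ^ 2 - t ^ 2 := ⟨_, Real.sq_sqrt (sub_nonneg.2 h)⟩
    refine ⟨(t * x + m * y) / (x ^ 2 + y ^ 2), (t * y - m * x) / (x ^ 2 + y ^ 2), m, ?_, ?_, ?_⟩
    · field_simp
      linear_combination (x ^ 2 + y ^ 2) * hm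
    · field_simp
      linear_combination (-x) * hm
    · field_simp
      linear_combination (-y) * hm

theorem trace_conjTranspose_mul_mul_vecMulVec {n : Type*} [Fintype n] (A D B : Matrix n n ℂ)
    (v : n → ℂ) :
    (Aᴴ * D * B * vecMulVec v (star v)).trace = star (A *ᵥ v) ⬝ᵥ (D *ᵥ (B *ᵥ v)) := by
  rw [mul_vecMulVec, trace_vecMulVec, dotProduct_comm, star_mulVec, ← dotProduct_mulVec,
    mulVec_mulVec, mulVec_mulVec, Matrix.mul_assoc]

/-- Kraus operators of a qubit channel, adapted to the input `χ = (c, s)` and its normal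
`η = (-s, c)`: the rows of the first are `t χ + m η` and `t χ - m η`, and the second, whose rows
are `0` and `g η`, annihilates `χ` and restores trace preservation. -/
def balancedKraus (c s t m g : ℝ) : Fin 2 → Matrix (Fin 2) (Fin 2) ℂ :=
  ![!![(t * c - m * s : ℝ), (t * s + m * c : ℝ); (t * c + m * s : ℝ), (t * s - m * c : ℝ)],
    !![0, 0; -(g * s : ℝ), (g * c : ℝ)]]

variable {c s t m g : ℝ}

theorem sum_balancedKraus_conjTranspose_mul (hcs : c ^ 2 + s ^ 2 = 1) (ht : 2 * t ^ 2 = 1)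
    (hg : g ^ 2 = 1 - 2 * m ^ 2) :
    ∑ j, (balancedKraus c s t m g j)ᴴ * balancedKraus c s t m g j = 1 := by
  have hcs' : (c : ℂ) ^ 2 + s ^ 2 = 1 := by exact_mod_cast hcs
  have ht' : 2 * (t : ℂ) ^ 2 = 1 := by exact_mod_cast ht
  have hg' : (g : ℂ) ^ 2 = 1 - 2 * m ^ 2 := by exact_mod_cast congrArg Complex.ofReal hg
  ext i j
  fin_cases i <;> fin_cases j <;> simp [balancedKraus, mul_apply]
  · linear_combination c ^ 2 * ht' + s ^ 2 * hg' + hcs'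
  · linear_combination c * s * ht' - s * c * hg'
  · linear_combination c * s * ht' - s * c * hg'
  · linear_combination s ^ 2 * ht' + c ^ 2 * hg' + hcs'

theorem sum_norm_sq_balancedKraus (hcs : c ^ 2 + s ^ 2 = 1) (ht : 2 * t ^ 2 = 1)
    (hg : g ^ 2 = 1 - 2 * m ^ 2) (k l : Fin 2) :
    ∑ j, ‖balancedKraus c s t m g j k l‖ ^ 2 =
      qubitAction ((t * c - m * s) ^ 2) (1 - (t * s + m * c) ^ 2) k l := by
  fin_cases k <;> fin_cases l <;>
    simp [balancedKraus, qubitAction, -Complex.ofReal_mul, -Complex.ofReal_add,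
      -Complex.ofReal_sub, Complex.norm_real, mul_pow]
  · linear_combination c ^ 2 * ht + s ^ 2 * hg + hcs
  · linear_combination s ^ 2 * ht + c ^ 2 * hg + hcs

theorem balancedKraus_mulVec (hcs : c ^ 2 + s ^ 2 = 1) (j : Fin 2) :
    balancedKraus c s t m g j *ᵥ ![(c : ℂ), (s : ℂ)] = ![![(t : ℂ), t], 0] j := by
  have hcs' : (c : ℂ) ^ 2 + s ^ 2 = 1 := by exact_mod_cast hcs
  ext k
  fin_cases j <;> fin_cases k <;> simp [balancedKraus]
  · linear_combination t * hcs'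
  · linear_combination t * hcs'
  · ring

theorem two_mem_distinguishableCounts_of_balancedKraus (hcs : c ^ 2 + s ^ 2 = 1)
    (ht : 2 * t ^ 2 = 1) (hg : g ^ 2 = 1 - 2 * m ^ 2) :
    2 ∈ distinguishableCounts (qubitAction ((t * c - m * s) ^ 2) (1 - (t * s + m * c) ^ 2)) := by
  have hχ : IsState (vecMulVec ![(c : ℂ), (s : ℂ)] (star ![(c : ℂ), (s : ℂ)])) := by
    refine ⟨posSemidef_vecMulVec_self_star _, ?_⟩
    simp only [trace_vecMulVec, dotProduct, Fin.sum_univ_two, Pi.star_apply, cons_val_zero,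
      cons_val_one, Complex.star_def, Complex.conj_ofReal, ← sq]
    exact_mod_cast hcs
  refine mem_distinguishableCounts_of_phases two_ne_zero
    (sum_balancedKraus_conjTranspose_mul hcs ht hg) (sum_norm_sq_balancedKraus hcs ht hg)
    (z := ![1, ![1, -1]]) (fun m k => ?_) hχ fun m n hmn i j => ?_
  · fin_cases m <;> fin_cases k <;> simp
  · rw [trace_conjTranspose_mul_mul_vecMulVec, balancedKraus_mulVec hcs,
      balancedKraus_mulVec hcs]
    fin_cases i <;> fin_cases j <;> fin_cases m <;> fin_cases n <;>
      simp [dotProduct] at hmn ⊢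

theorem two_mem_distinguishableCounts_of_le {a b : ℝ} (ha : 0 ≤ a) (hb : b ≤ 1) (hab : a ≤ b)
    (hba : b - a ≤ 1 / 2) : 2 ∈ distinguishableCounts (qubitAction a b) := by
  obtain ⟨t, ht⟩ : ∃ t : ℝ, t ^ 2 = 1 / 2 := ⟨√(1 / 2), Real.sq_sqrt (by norm_num)⟩
  have hx : √a ^ 2 = a := Real.sq_sqrt ha
  have hy : √(1 - b) ^ 2 = 1 - b := Real.sq_sqrt (by linarith)
  obtain ⟨c, s, m, hcs, hxm, hym⟩ : ∃ c s m : ℝ, c ^ 2 + s ^ 2 = 1 ∧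
      √a = t * c - m * s ∧ √(1 - b) = t * s + m * c :=
    exists_unit_vector_component_eq (by linarith)
  have hm : 0 ≤ 1 - 2 * m ^ 2 := by
    have hlen : √a ^ 2 + √(1 - b) ^ 2 = t ^ 2 + m ^ 2 := by
      rw [hxm, hym]
      linear_combination (t ^ 2 + m ^ 2) * hcs
    linarith
  have htwo := two_mem_distinguishableCounts_of_balancedKraus (t := t) hcs (by linarith)
    (Real.sq_sqrt hm)
  rwa [← hxm, ← hym, hx, hy, sub_sub_cancel] at htwo

theorem qubitAction_submatrix_swap (a b : ℝ) :
    (qubitAction a b).submatrix (Equiv.swap 0 1) id = qubitAction (1 - a) (1 - b) := by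
  ext k l
  fin_cases k <;> fin_cases l <;> simp [qubitAction]

theorem two_mem_distinguishableCounts {a b : ℝ} (ha : a ∈ Set.Icc (0 : ℝ) 1)
    (hb : b ∈ Set.Icc (0 : ℝ) 1) (hab : |a - b| ≤ 1 / 2) :
    2 ∈ distinguishableCounts (qubitAction a b) := by
  obtain ⟨hba, hab'⟩ := abs_le.1 hab
  rcases le_total a b with hle | hle
  · exact two_mem_distinguishableCounts_of_le ha.1 hb.2 hle (by linarith)
  · have hflip : 2 ∈ distinguishableCounts (qubitAction (1 - a) (1 - b)) :=
      two_mem_distinguishableCounts_of_le (sub_nonneg.2 ha.2) (sub_le_self 1 hb.1)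
        (sub_le_sub_left hle 1) (by linarith)
    have hswap := mem_distinguishableCounts_submatrix (Equiv.swap 0 1) hflip
    rwa [qubitAction_submatrix_swap, sub_sub_cancel, sub_sub_cancel] at hswap

end TwoChannels

section QubitUpperBounds

variable {a b : ℝ} {M : ℕ}

theorem eq_of_mem_distinguishableCounts_qubitAction
    (h : M ∈ distinguishableCounts (qubitAction a b)) (hM : 2 < M) : a = b := by
  have hrow := sum_row_eq_one_of_mem_distinguishableCounts h (by simpa using hM) 0
  simp only [qubitAction, Fin.sum_univ_two, of_apply, cons_val_zero, cons_val_one] at hrow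
  linarith

theorem eq_half_of_four_mem_distinguishableCounts_qubitAction
    (h : 4 ∈ distinguishableCounts (qubitAction a b)) : a = 1 / 2 := by
  have hentry := apply_eq_inv_of_sq_mem_distinguishableCounts (d := 2) h 0 0
  simpa [qubitAction] using hentry

theorem le_four_of_mem_distinguishableCounts_qubitAction
    (h : M ∈ distinguishableCounts (qubitAction a b)) : M ≤ 4 := by
  simpa using le_sq_of_mem_distinguishableCounts h

end QubitUpperBounds

end QubitDist

theorem mainTheorem10 (a b : ℝ) (ha : a ∈ Set.Icc (0 : ℝ) 1) (hb : b ∈ Set.Icc (0 : ℝ) 1) :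
    (0 < |a - b| ∧ |a - b| ≤ 1 / 2 →
      QubitDist.IsDistinguishabilityNumber (QubitDist.qubitAction a b) 2) ∧
    (a = b ∧ a ∈ Set.Icc (1 / 3 : ℝ) (2 / 3) \ {1 / 2} →
      QubitDist.IsDistinguishabilityNumber (QubitDist.qubitAction a b) 3) ∧
    (a = b ∧ a = 1 / 2 →
      QubitDist.IsDistinguishabilityNumber (QubitDist.qubitAction a b) 4) := by
  refine ⟨?_, ?_, ?_⟩
  · rintro ⟨hpos, hle⟩
    refine ⟨QubitDist.two_mem_distinguishableCounts ha hb hle, fun M hM => ?_⟩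
    by_contra! hlt
    have hab : a = b := QubitDist.eq_of_mem_distinguishableCounts_qubitAction hM hlt
    simp [hab] at hpos
  · rintro ⟨rfl, hIcc, hne⟩
    refine ⟨QubitDist.three_mem_distinguishableCounts hIcc, fun M hM => ?_⟩
    by_contra! hlt
    obtain rfl : M = 4 :=
      (QubitDist.le_four_of_mem_distinguishableCounts_qubitAction hM).antisymm hlt
    exact hne (QubitDist.eq_half_of_four_mem_distinguishableCounts_qubitAction hM)
  · rintro ⟨rfl, rfl⟩
    exact ⟨QubitDist.four_mem_distinguishableCounts,
      fun M hM => QubitDist.le_four_of_mem_distinguishableCounts_qubitAction hM⟩
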